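/- Let $G$ be a locally compact Hausdorff group, let $H$ be a closed normal subgroup of $G$, and let $\pi : G \to G/H$ be the quotient map. Assume that $G$ and $G/H$ are both unimodular (their left Haar measures are right invariant). Let $\mu$ be a Haar measure on $G$ and let $\mu_{G/H}$ be a Haar measure on $G/H$. Let $A \subseteq G$ be $\sigma$-compact with $0 < \mu(A) < \infty$. Write $XY = \{xy : x \in X,\ y \in Y\}$, $X^2 = XX$, $X^{-1} = \{x^{-1} : x \in X\}$, and $\pi A^2 = \pi(A)^2$. Let $K, K_1, K_2 \ge 0$ be real numbers. (i) If $\mu(A^2) \le K\mu(A)$ and $A = A^{-1}$, then $\mu_{G/H}(\pi A^2) \le K^2 \mu_{G/H}(\pi A)$. (ii) If $\mu(A^2) \le K\mu(A)$, then $\mu_{G/H}(\pi A^2) \le K^3 \mu_{G/H}(\pi A)$. (iii) If $\mu(A^2) \le K_1\mu(A)$ and $\mu(A^{-1}A) \le K_2\mu(A)$, then $\mu_{G/H}(\pi A^2) \le K_1 K_2\, \mu_{G/H}(\pi A)$. -/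

import Mathlib

open MeasureTheory
open scoped Pointwise NNReal ENNReal

/-! ### Integration along the fibres of `ψ` -/

section FiberIntegral

set_option linter.unusedSectionVars false

open MeasureTheory.Measure CompactlySupportedContinuousMap

variable {G Q : Type*} [Group G] [TopologicalSpace G] [IsTopologicalGroup G]
  [LocallyCompactSpace G] [T2Space G] [MeasurableSpace G] [BorelSpace G]
  [Group Q] [TopologicalSpace Q] [IsTopologicalGroup Q] [MeasurableSpace Q] [BorelSpace Q]
  {H : Subgroup G} {ψ : G →* Q}

/-! Everything follows from one inequality, with `ψ` the quotient map: `ν(ψ(XY)) μ(W)² ≤ μ(XW)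
μ(W⁻¹Y) ν(ψW)`. For `X = Y = W = A` it gives (iii) after division by `μ(A)²`, and (i) since `A⁻¹A =
A²` for symmetric `A`. With trivial `H`, `X = W = A⁻¹` and `Y = A`, it gives `μ(A⁻¹A) μ(A) ≤
μ(A²)²`, so (ii) is (iii) with `K₂ = K²`.

The inequality is a double count. Let `u`, `v` be the indicators of `XW`, `W⁻¹Y`, and let `V` be the
fibre integral of `v`. If `q = ψ(xy)` and `s`, `sh⁻¹` lie in `W` with `h ∈ H`, then `xs ∈ XW`,
`hs⁻¹y ∈ W⁻¹Y`, and their images multiply to `q`. Hence `∫ u(z) V(ψ(z)⁻¹q) dμ(z)` is at least the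
measure of such pairs `(s, h)`, which is the squared `L²` norm of the fibre integral of the
indicator of `W`, up to the constant of the quotient integral formula. Cauchy–Schwarz bounds it
below by `μ(W)² / ν(ψW)`, up to a constant. Integrating over `q ∈ ψ(XY)` bounds the total by `∫ u ·
∫ V` (`measureReal_mul_integral_le`), and the constants cancel.

The code runs this with continuous compactly supported functions, then passes to compact and to
σ-compact sets. -/

theorem exists_integral_eq_mul_integral_pushforward
    (S : TopologicalGroup.IsSES H.subtype ψ) (lam : Measure H) [lam.IsHaarMeasure]
    (μ : Measure G) [μ.IsHaarMeasure] (ν : Measure Q) [ν.IsHaarMeasure] :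
    ∃ c : ℝ, 0 < c ∧ ∀ f : CompactlySupportedContinuousMap G ℝ,
      ∫ x, f x ∂μ = c * ∫ q, S.pushforward lam f q ∂ν := by
  refine ⟨haarScalarFactor μ (S.inducedMeasure lam ν),
    NNReal.coe_pos.2 (haarScalarFactor_pos_of_isHaarMeasure _ _), fun f ↦ ?_⟩
  rw [integral_isMulLeftInvariant_eq_smul_of_hasCompactSupport μ (S.inducedMeasure lam ν)
    (f := f) (by fun_prop) f.hasCompactSupport, integral_smul_nnreal_measure, S.integral_inducedMeasure,
    S.integrate_apply, NNReal.smul_def, smul_eq_mul]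

theorem pushforward_apply_map (S : TopologicalGroup.IsSES H.subtype ψ) (lam : Measure H)
    [lam.IsHaarMeasure] (f : CompactlySupportedContinuousMap G ℝ) (g : G) :
    S.pushforward lam f (ψ g) = ∫ h : H, f (g * h) ∂lam := by
  rw [S.pushforward_apply_apply]
  simp [S.pullback_def]

theorem hasCompactSupport_subgroup_comp (S : TopologicalGroup.IsSES H.subtype ψ)
    (f : CompactlySupportedContinuousMap G ℝ) (e : G ≃ₜ G) :
    HasCompactSupport (fun h : H ↦ f (e h)) :=
  (f.hasCompactSupport.comp_homeomorph e).comp_isClosedEmbedding S.isClosedEmbedding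

/-- Conjugation by `g` scales `lam` by some factor. The quotient integral formula compares that
factor with the effects of conjugation on `μ` and `ν`; both are trivial by unimodularity, so the
factor is 1. -/
theorem integral_conj_subgroup [H.Normal] (S : TopologicalGroup.IsSES H.subtype ψ)
    (lam : Measure H) [lam.IsHaarMeasure]
    (μ : Measure G) [μ.IsHaarMeasure] [μ.IsMulRightInvariant]
    (ν : Measure Q) [ν.IsHaarMeasure] [ν.IsMulRightInvariant]
    (g : G) {k : H → ℝ} (hk : Continuous k) (hk' : HasCompactSupport k) :
    ∫ h, k (MulAut.conjNormal g h) ∂lam = ∫ h, k h ∂lam := by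
  have : LocallyCompactSpace H := S.isClosedEmbedding.locallyCompactSpace
  let e : H ≃ₜ* H :=
    { MulAut.conjNormal g with
      continuous_toFun := by
        refine Continuous.subtype_mk (f := fun h : H ↦ g * h * g⁻¹) (by fun_prop) _
      continuous_invFun := by
        refine Continuous.subtype_mk (f := fun h : H ↦ g⁻¹ * h * (g⁻¹)⁻¹) (by fun_prop) _ }
  have he' : MeasurableEmbedding e := e.toHomeomorph.isClosedEmbedding.measurableEmbedding
  have key : ∀ k : H → ℝ, Continuous k → HasCompactSupport k →
      ∫ h, k (MulAut.conjNormal g h) ∂lam =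
        haarScalarFactor (lam.map e) lam * ∫ h, k h ∂lam := fun k hk hk' ↦ by
    have : (lam.map e).IsHaarMeasure := e.isHaarMeasure_map lam
    have h1 := integral_isMulLeftInvariant_eq_smul_of_hasCompactSupport (lam.map e) lam hk hk'
    rw [integral_smul_nnreal_measure, NNReal.smul_def, smul_eq_mul,
      he'.integral_map] at h1
    exact h1
  obtain ⟨c, hc, hcμ⟩ := exists_integral_eq_mul_integral_pushforward S lam μ ν
  obtain ⟨f, hf, hf0, hf1⟩ := exists_continuous_nonneg_pos (1 : G)
  let f₀ : CompactlySupportedContinuousMap G ℝ := ⟨f, hf⟩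
  let e' : G ≃ₜ G := (Homeomorph.mulLeft g).trans (Homeomorph.mulRight g⁻¹)
  let f₁ : CompactlySupportedContinuousMap G ℝ := ⟨⟨fun x ↦ f (e' x), by fun_prop⟩,
    hf.comp_homeomorph e'⟩
  have h₁ (x : G) : f₁ x = f₀ (g * x * g⁻¹) := rfl
  have hpos : 0 < ∫ x, f₀ x ∂μ :=
    f.continuous.integral_pos_of_hasCompactSupport_nonneg_nonzero hf hf0 hf1
  have e₁ : ∫ x, f₁ x ∂μ = ∫ x, f₀ x ∂μ := by
    simp_rw [h₁]
    rw [integral_mul_left_eq_self (fun x ↦ f₀ (x * g⁻¹)) g, integral_mul_right_eq_self]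
  have hq (q : Q) : S.pushforward lam f₁ q =
      haarScalarFactor (lam.map e) lam * S.pushforward lam f₀ (ψ g * q * (ψ g)⁻¹) := by
    obtain ⟨x, rfl⟩ := S.isOpenQuotientMap.surjective q
    rw [← map_inv, ← map_mul, ← map_mul, pushforward_apply_map, pushforward_apply_map,
      ← key (fun h ↦ f₀ (g * x * g⁻¹ * h)) (by fun_prop)
        (hasCompactSupport_subgroup_comp S f₀ (Homeomorph.mulLeft _))]
    congr with h
    rw [h₁]
    simp [mul_assoc]
  have e₂ : ∫ q, S.pushforward lam f₁ q ∂ν =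
      haarScalarFactor (lam.map e) lam * ∫ q, S.pushforward lam f₀ q ∂ν := by
    simp_rw [hq]
    rw [integral_const_mul,
      integral_mul_left_eq_self (fun x ↦ S.pushforward lam f₀ (x * (ψ g)⁻¹)) (ψ g),
      integral_mul_right_eq_self]
  rw [hcμ, hcμ, e₂] at e₁
  rw [hcμ] at hpos
  have h2 := mul_left_cancel₀ hc.ne' e₁
  have h3 : ∫ q, S.pushforward lam f₀ q ∂ν ≠ 0 := fun h ↦ by simp [h] at hpos
  rw [key k hk hk', (mul_eq_right₀ h3).1 h2, one_mul]

theorem integral_subgroup_mul_comm [H.Normal] (S : TopologicalGroup.IsSES H.subtype ψ)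
    (lam : Measure H) [lam.IsHaarMeasure]
    (μ : Measure G) [μ.IsHaarMeasure] [μ.IsMulRightInvariant]
    (ν : Measure Q) [ν.IsHaarMeasure] [ν.IsMulRightInvariant]
    (f : CompactlySupportedContinuousMap G ℝ) (g : G) :
    ∫ h : H, f (g * h) ∂lam = ∫ h : H, f (h * g) ∂lam := by
  rw [← integral_conj_subgroup S lam μ ν g (k := fun h ↦ f (h * g)) (by fun_prop)
    (hasCompactSupport_subgroup_comp S f (Homeomorph.mulRight g))]
  simp [mul_assoc]

/-- After Fubini, the right translation `s ↦ sh` in `μ` turns `f(s) f(sh⁻¹)` into `f(sh) f(s)`. -/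
theorem integral_mul_integral_subgroup_inv (S : TopologicalGroup.IsSES H.subtype ψ)
    (lam : Measure H) [lam.IsHaarMeasure]
    (μ : Measure G) [μ.IsHaarMeasure] [μ.IsMulRightInvariant]
    (f : CompactlySupportedContinuousMap G ℝ) :
    ∫ s, f s * ∫ h : H, f (s * (h : G)⁻¹) ∂lam ∂μ =
      ∫ s, f s * ∫ h : H, f (s * h) ∂lam ∂μ := by
  have hK : IsCompact (tsupport f) := f.hasCompactSupport
  have hf {x} (hx : x ∉ tsupport f) : f x = 0 := image_eq_zero_of_notMem_tsupport hx
  -- Fubini without σ-finiteness: the integrand vanishes unless `s` and `s * e h` lie in the support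
  -- of `f`, which confines `e h` to a compact set.
  have swap (e : H → H) (he : Continuous e) (he' : IsCompact
      (e ⁻¹' ((↑) ⁻¹' ((tsupport f)⁻¹ * tsupport f)))) :
      ∫ s, f s * ∫ h : H, f (s * e h) ∂lam ∂μ = ∫ h : H, ∫ s, f s * f (s * e h) ∂μ ∂lam := by
    simp_rw [← integral_const_mul]
    refine integral_integral_swap_of_hasCompactSupport (f := fun s h ↦ f s * f (s * e h))
      (by simp only [Function.uncurry_def]; fun_prop) ?_
    refine HasCompactSupport.intro (hK.prod he') fun p hp ↦ ?_
    simp only [Function.uncurry_def, mul_eq_zero]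
    by_contra! h
    refine hp ⟨not_not.1 fun h' ↦ h.1 (hf h'), ?_⟩
    exact ⟨p.1⁻¹, Set.inv_mem_inv.2 (not_not.1 fun h' ↦ h.1 (hf h')), p.1 * e p.2,
      not_not.1 fun h' ↦ h.2 (hf h'), by simp⟩
  have hC : IsCompact ((fun h : H ↦ (h : G)) ⁻¹' ((tsupport f)⁻¹ * tsupport f)) :=
    S.isClosedEmbedding.isCompact_preimage (hK.inv.mul hK)
  have h1 := swap (·⁻¹) continuous_inv ((Homeomorph.inv H).isCompact_preimage.2 hC)
  have h2 := swap id continuous_id hC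
  simp only [Subgroup.coe_inv, id] at h1 h2
  rw [h1, h2]
  congr with h
  rw [← integral_mul_right_eq_self _ (h : G)]
  simp [mul_comm]

end FiberIntegral

/-! ### The convolution inequality for functions -/

section FiberConvolution

set_option linter.unusedSectionVars false

open MeasureTheory.Measure CompactlySupportedContinuousMap

variable {G Q : Type*} [Group G] [TopologicalSpace G] [IsTopologicalGroup G]
  [LocallyCompactSpace G] [T2Space G] [MeasurableSpace G] [BorelSpace G]
  [Group Q] [TopologicalSpace Q] [IsTopologicalGroup Q] [T2Space Q]
  [MeasurableSpace Q] [BorelSpace Q]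
  {H : Subgroup G} {ψ : G →* Q}

theorem integral_mul_integral_subgroup_eq (S : TopologicalGroup.IsSES H.subtype ψ)
    (lam : Measure H) [lam.IsHaarMeasure] (μ : Measure G) (ν : Measure Q) [ν.IsHaarMeasure]
    {c : ℝ} (hc : ∀ f : CompactlySupportedContinuousMap G ℝ,
      ∫ x, f x ∂μ = c * ∫ q, S.pushforward lam f q ∂ν)
    (f : CompactlySupportedContinuousMap G ℝ) :
    ∫ s, f s * ∫ h : H, f (s * h) ∂lam ∂μ = c * ∫ q, S.pushforward lam f q ^ 2 ∂ν := by
  have hψ := S.isOpenQuotientMap.continuous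
  -- The pushforward of `f` is constant on fibres, so it factors out of the fibre integral of `k`,
  -- leaving its square.
  let k : CompactlySupportedContinuousMap G ℝ :=
    ⟨⟨fun s ↦ f s * S.pushforward lam f (ψ s), by fun_prop⟩, f.hasCompactSupport.mul_right⟩
  have hk (s : G) : k s = f s * S.pushforward lam f (ψ s) := rfl
  have h1 := hc k
  have h2 (q : Q) : S.pushforward lam k q = S.pushforward lam f q ^ 2 := by
    obtain ⟨x, rfl⟩ := S.isOpenQuotientMap.surjective q
    rw [pushforward_apply_map]
    have (h : H) : ψ h = 1 := S.mulExact.apply_apply_eq_one h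
    simp_rw [hk, map_mul, this, mul_one]
    rw [integral_mul_const, sq, pushforward_apply_map]
  simp_rw [h2] at h1
  rw [← h1]
  simp_rw [hk, pushforward_apply_map]

theorem sq_integral_le_measure_mul_integral_sq (ν : Measure Q) [IsFiniteMeasureOnCompacts ν]
    (F : CompactlySupportedContinuousMap Q ℝ) {T : Set Q} (hT : IsCompact T)
    (hF : ∀ q ∉ T, F q = 0) :
    (∫ q, F q ∂ν) ^ 2 ≤ ν.real T * ∫ q, F q ^ 2 ∂ν := by
  have h1 : ∫ q in T, F q ∂ν = ∫ q, F q ∂ν :=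
    setIntegral_eq_integral_of_forall_compl_eq_zero hF
  have h2 : ∫ q in T, F q ^ 2 ∂ν = ∫ q, F q ^ 2 ∂ν :=
    setIntegral_eq_integral_of_forall_compl_eq_zero fun q hq ↦ by simp [hF q hq]
  have i1 : IntegrableOn F T ν := F.integrable.integrableOn
  have i2 : IntegrableOn (fun q ↦ F q ^ 2) T ν :=
    ContinuousOn.integrableOn_compact hT (by fun_prop)
  have i0 (a : ℝ) : IntegrableOn (fun _ : Q ↦ a) T ν := integrableOn_const hT.measure_ne_top
  rw [← h1, ← h2]
  set I := ∫ q in T, F q ∂ν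
  set J := ∫ q in T, F q ^ 2 ∂ν
  set m := ν.real T
  -- Cauchy–Schwarz as the discriminant of the nonnegative quadratic `t ↦ ∫_T (tF - 1)²`.
  have h3 (t : ℝ) : 0 ≤ J * (t * t) + (-2 * I) * t + m := by
    have h : 0 ≤ ∫ q in T, (t * F q - 1) ^ 2 ∂ν := integral_nonneg fun q ↦ sq_nonneg _
    have e : ∫ q in T, (t * F q - 1) ^ 2 ∂ν =
        ∫ q in T, (t ^ 2 * F q ^ 2 - 2 * t * F q + 1) ∂ν := by
      congr with q; ring
    have i3 : IntegrableOn (fun q ↦ t ^ 2 * F q ^ 2 - 2 * t * F q) T ν :=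
      (i2.const_mul _).sub (i1.const_mul _)
    rw [e, integral_add i3 (i0 1),
      integral_sub (i2.const_mul _) (i1.const_mul _), integral_const_mul, integral_const_mul,
      setIntegral_const] at h
    simp only [smul_eq_mul, mul_one] at h
    linarith
  have := discrim_le_zero h3
  rw [discrim] at this
  linarith

/-- Both sides are compared with the integral over `q ∈ ψ '' (X * Y)` of the convolution of `u` with
the fibre integral of `v`. The conditions `hfu`, `hfv` say that `u`, `v` dominate the indicators of
`XW`, `W⁻¹Y` when `f` plays the indicator of `W`. -/
theorem measureReal_mul_integral_le [H.Normal] (S : TopologicalGroup.IsSES H.subtype ψ)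
    (lam : Measure H) [lam.IsHaarMeasure]
    (μ : Measure G) [μ.IsHaarMeasure] [μ.IsMulRightInvariant]
    (ν : Measure Q) [ν.IsHaarMeasure] [ν.IsMulRightInvariant]
    {f u v : CompactlySupportedContinuousMap G ℝ} (hf : 0 ≤ f) (hu : 0 ≤ u) (hv : 0 ≤ v)
    {X Y : Set G} (hX : IsCompact X) (hY : IsCompact Y)
    (hfu : ∀ x ∈ X, ∀ s, f s ≤ u (x * s)) (hfv : ∀ y ∈ Y, ∀ s, f s ≤ v (s⁻¹ * y)) :
    ν.real (ψ '' (X * Y)) * ∫ s, f s * ∫ h : H, f (s * h) ∂lam ∂μ ≤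
      (∫ x, u x ∂μ) * ∫ q, S.pushforward lam v q ∂ν := by
  have hψ := S.isOpenQuotientMap.continuous
  have hT : IsCompact (ψ '' (X * Y)) := (hX.mul hY).image hψ
  set T := ψ '' (X * Y)
  set V := S.pushforward lam v with hVdef
  have hV : 0 ≤ V := by
    have := S.pushforward_mono lam hv
    rwa [map_zero] at this
  have hK : IsCompact (tsupport u) := u.hasCompactSupport
  have hu0 {x} (hx : x ∉ tsupport u) : u x = 0 := image_eq_zero_of_notMem_tsupport hx
  have hV0 {x} (hx : x ∉ tsupport V) : V x = 0 := image_eq_zero_of_notMem_tsupport hx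
  have hcont : Continuous fun q ↦ ∫ x, u x * V ((ψ x)⁻¹ * q) ∂μ := by
    rw [← continuousOn_univ]
    refine continuousOn_integral_of_compact_support hK (by
      simp only [Function.uncurry_def]; fun_prop) fun q x _ hx ↦ by rw [hu0 hx, zero_mul]
  have swap : ∫ x, ∫ q in T, u x * V ((ψ x)⁻¹ * q) ∂ν ∂μ =
      ∫ q in T, ∫ x, u x * V ((ψ x)⁻¹ * q) ∂μ ∂ν := by
    refine integral_integral_swap_of_hasCompactSupport
      (f := fun x q ↦ u x * V ((ψ x)⁻¹ * q)) (by simp only [Function.uncurry_def]; fun_prop) ?_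
    refine HasCompactSupport.intro
      (hK.prod ((hK.image hψ).mul V.hasCompactSupport)) fun p hp ↦ ?_
    simp only [Function.uncurry_def, mul_eq_zero]
    by_contra! h
    have h' : p.1 ∈ tsupport u := not_not.1 fun h' ↦ h.1 (hu0 h')
    exact hp ⟨h', ψ p.1, Set.mem_image_of_mem _ h', (ψ p.1)⁻¹ * p.2,
      not_not.1 fun h' ↦ h.2 (hV0 h'), by simp⟩
  have upper : ∫ x, ∫ q in T, u x * V ((ψ x)⁻¹ * q) ∂ν ∂μ ≤ (∫ x, u x ∂μ) * ∫ q, V q ∂ν := by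
    rw [← integral_mul_const]
    refine integral_mono_of_nonneg
      (.of_forall fun x ↦ integral_nonneg fun q ↦ mul_nonneg (hu x) (hV _))
      (u.integrable.mul_const _) (.of_forall fun x ↦ ?_)
    simp only
    rw [integral_const_mul, ← integral_mul_left_eq_self V (ψ x)⁻¹]
    refine mul_le_mul_of_nonneg_left (setIntegral_le_integral ?_
      (.of_forall fun q ↦ hV _)) (hu x)
    exact V.integrable.comp_mul_left _
  have inner (y : G) (hy : y ∈ Y) (s : G) :
      ∫ h : H, f (s * (h : G)⁻¹) ∂lam ≤ V (ψ (s⁻¹ * y)) := by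
    -- `hfv` bounds `f(sh⁻¹)` by `v(hs⁻¹y)`, with `h` on the left, while the fibre integral puts `h`
    -- on the right.
    rw [hVdef, pushforward_apply_map, integral_subgroup_mul_comm S lam μ ν]
    refine integral_mono_of_nonneg (.of_forall fun h ↦ hf _)
      (Continuous.integrable_of_hasCompactSupport (by fun_prop)
        (hasCompactSupport_subgroup_comp S v (Homeomorph.mulRight (s⁻¹ * y))))
      (.of_forall fun h ↦ ?_)
    simpa [mul_assoc] using hfv y hy (s * (h : G)⁻¹)
  have lower (q : Q) (hq : q ∈ T) :
      ∫ s, f s * ∫ h : H, f (s * h) ∂lam ∂μ ≤ ∫ x, u x * V ((ψ x)⁻¹ * q) ∂μ := by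
    obtain ⟨_, ⟨x, hx, y, hy, rfl⟩, rfl⟩ := hq
    rw [← integral_mul_integral_subgroup_inv S, 
      ← integral_mul_left_eq_self (fun z ↦ u z * V ((ψ z)⁻¹ * ψ (x * y))) x]
    have e (s : G) : (ψ (x * s))⁻¹ * ψ (x * y) = ψ (s⁻¹ * y) := by simp [mul_assoc]
    simp only [e]
    refine integral_mono_of_nonneg
      (.of_forall fun s ↦ mul_nonneg (hf s) (integral_nonneg fun h ↦ hf _))
      (Continuous.integrable_of_hasCompactSupport (by fun_prop)
        ((u.hasCompactSupport.comp_homeomorph (Homeomorph.mulLeft x)).mul_right))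
      (.of_forall fun s ↦ ?_)
    exact mul_le_mul (hfu x hx s) (inner y hy s) (integral_nonneg fun h ↦ hf _) (hu _)
  refine le_trans ?_ (swap.symm.le.trans upper)
  have := setIntegral_mono_on (μ := ν) (integrableOn_const hT.measure_ne_top)
    (hcont.continuousOn.integrableOn_compact hT) hT.measurableSet lower
  rwa [setIntegral_const, smul_eq_mul] at this

theorem measureReal_mul_sq_integral_le [H.Normal] (S : TopologicalGroup.IsSES H.subtype ψ)
    (μ : Measure G) [μ.IsHaarMeasure] [μ.IsMulRightInvariant]
    (ν : Measure Q) [ν.IsHaarMeasure] [ν.IsMulRightInvariant]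
    {f u v : CompactlySupportedContinuousMap G ℝ} (hf : 0 ≤ f) (hu : 0 ≤ u) (hv : 0 ≤ v)
    {X Y : Set G} (hX : IsCompact X) (hY : IsCompact Y)
    (hfu : ∀ x ∈ X, ∀ s, f s ≤ u (x * s)) (hfv : ∀ y ∈ Y, ∀ s, f s ≤ v (s⁻¹ * y)) :
    ν.real (ψ '' (X * Y)) * (∫ s, f s ∂μ) ^ 2 ≤
      (∫ x, u x ∂μ) * (∫ x, v x ∂μ) * ν.real (ψ '' tsupport f) := by
  have : LocallyCompactSpace H := S.isClosedEmbedding.locallyCompactSpace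
  let lam : Measure H := haar
  obtain ⟨c, hc, hcμ⟩ := exists_integral_eq_mul_integral_pushforward S lam μ ν
  have h1 := measureReal_mul_integral_le S lam μ ν hf hu hv hX hY hfu hfv
  rw [integral_mul_integral_subgroup_eq S lam μ ν hcμ] at h1
  have h2 := sq_integral_le_measure_mul_integral_sq ν (S.pushforward lam f)
    (T := ψ '' tsupport f) (f.hasCompactSupport.isCompact.image S.isOpenQuotientMap.continuous)
    fun q hq ↦ by
      obtain ⟨x, rfl⟩ := S.isOpenQuotientMap.surjective q
      rw [pushforward_apply_map]
      refine integral_eq_zero_of_ae (.of_forall fun h ↦ image_eq_zero_of_notMem_tsupport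
        fun h' ↦ hq ⟨_, h', ?_⟩)
      have : ψ h = 1 := S.mulExact.apply_apply_eq_one h
      simp [this]
  rw [hcμ f, hcμ v]
  calc _ = c ^ 2 * ν.real (ψ '' (X * Y)) * (∫ q, S.pushforward lam f q ∂ν) ^ 2 := by ring
    _ ≤ c ^ 2 * ν.real (ψ '' (X * Y)) *
        (ν.real (ψ '' tsupport f) * ∫ q, S.pushforward lam f q ^ 2 ∂ν) := by gcongr
    _ = c * ν.real (ψ '' tsupport f) *
        (ν.real (ψ '' (X * Y)) * (c * ∫ q, S.pushforward lam f q ^ 2 ∂ν)) := by ring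
    _ ≤ c * ν.real (ψ '' tsupport f) *
        ((∫ x, u x ∂μ) * ∫ q, S.pushforward lam v q ∂ν) := by gcongr
    _ = _ := by ring

end FiberConvolution

/-! ### From functions to compact and σ-compact sets -/

section Covering

set_option linter.unusedSectionVars false

open MeasureTheory.Measure

/-- `μ` need not be regular, but `haar` is, and the two are proportional on sets with compact
closure. Cutting the open set down to the interior of a compact neighbourhood keeps it in that
range. -/
theorem IsCompact.exists_isOpen_measure_lt_of_isHaarMeasure {G : Type*} [Group G]
    [TopologicalSpace G] [IsTopologicalGroup G] [LocallyCompactSpace G] [MeasurableSpace G]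
    [BorelSpace G] (μ : Measure G) [μ.IsHaarMeasure] {K : Set G} (hK : IsCompact K)
    {r : ℝ≥0∞} (hr : μ K < r) : ∃ U, IsOpen U ∧ K ⊆ U ∧ μ U < r := by
  obtain ⟨L, hL, hKL⟩ := exists_compact_superset hK
  have hc := haarScalarFactor_pos_of_isHaarMeasure μ (haar : Measure G)
  set c := haarScalarFactor μ (haar : Measure G)
  have hc0 : (c : ℝ≥0∞) ≠ 0 := by exact_mod_cast hc.ne'
  have e (s : Set G) (hs : IsCompact (closure s)) : μ s = c * haar s := by
    rw [measure_isMulInvariant_eq_smul_of_isCompact_closure μ haar hs]; rfl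
  rw [e K hK.closure, mul_comm, ← ENNReal.lt_div_iff_mul_lt (.inl hc0) (.inl (by simp))] at hr
  obtain ⟨U, hKU, hU, hUr⟩ := K.exists_isOpen_lt_of_lt _ hr
  refine ⟨U ∩ interior L, hU.inter isOpen_interior, Set.subset_inter hKU hKL, ?_⟩
  rw [e _ (hL.closure.of_isClosed_subset isClosed_closure
      (closure_mono (Set.inter_subset_right.trans interior_subset))), mul_comm,
    ← ENNReal.lt_div_iff_mul_lt (.inl hc0) (.inl (by simp))]
  exact (measure_mono Set.inter_subset_left).trans_lt hUr

theorem IsCompact.exists_compactlySupported_between {G : Type*} [TopologicalSpace G] [T2Space G]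
    [LocallyCompactSpace G] {K U : Set G} (hK : IsCompact K) (hU : IsOpen U) (hKU : K ⊆ U) :
    ∃ f : CompactlySupportedContinuousMap G ℝ, (∀ x ∈ K, f x = 1) ∧ 0 ≤ f ∧ (∀ x, f x ≤ 1) ∧
      tsupport f ⊆ U := by
  obtain ⟨f, hf1, hf2, hf3, hf4⟩ := exists_continuousMap_one_of_isCompact_subset_isOpen hK hU hKU
  exact ⟨⟨f, hf2⟩, hf1, fun x ↦ (hf4 x).1, fun x ↦ (hf4 x).2, hf3⟩

theorem ofReal_integral_le_measure {G : Type*} [TopologicalSpace G] [MeasurableSpace G]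
    [BorelSpace G] (μ : Measure G) [IsFiniteMeasureOnCompacts μ] {U : Set G}
    {f : CompactlySupportedContinuousMap G ℝ} (hf0 : 0 ≤ f) (hf1 : ∀ x, f x ≤ 1)
    (hf : tsupport f ⊆ U) : ENNReal.ofReal (∫ x, f x ∂μ) ≤ μ U := by
  refine le_trans ?_ (measure_mono hf)
  rw [ofReal_integral_eq_lintegral_ofReal f.integrable (.of_forall hf0),
    ← lintegral_indicator_one (isClosed_tsupport f).measurableSet]
  refine lintegral_mono fun x ↦ ?_
  by_cases hx : x ∈ tsupport f
  · simpa [hx] using hf1 x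
  · simp [hx, image_eq_zero_of_notMem_tsupport hx]

theorem measure_le_ofReal_integral {G : Type*} [TopologicalSpace G] [MeasurableSpace G]
    [BorelSpace G] (μ : Measure G) [IsFiniteMeasureOnCompacts μ] {K : Set G}
    (hK : MeasurableSet K)
    {f : CompactlySupportedContinuousMap G ℝ} (hf0 : 0 ≤ f) (hf : ∀ x ∈ K, f x = 1) :
    μ K ≤ ENNReal.ofReal (∫ x, f x ∂μ) := by
  rw [ofReal_integral_eq_lintegral_ofReal f.integrable (.of_forall hf0),
    ← lintegral_indicator_one hK]
  refine lintegral_mono fun x ↦ ?_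
  by_cases hx : x ∈ K
  · simp [hx, hf x hx]
  · simp [hx]

variable {G Q : Type*} [Group G] [TopologicalSpace G] [IsTopologicalGroup G]
  [LocallyCompactSpace G] [T2Space G] [MeasurableSpace G] [BorelSpace G]
  [Group Q] [TopologicalSpace Q] [IsTopologicalGroup Q] [T2Space Q]
  [MeasurableSpace Q] [BorelSpace Q]
  {H : Subgroup G} {ψ : G →* Q}

theorem IsCompact.measure_image_mul_mul_sq_le [H.Normal]
    (S : TopologicalGroup.IsSES H.subtype ψ)
    (μ : Measure G) [μ.IsHaarMeasure] [μ.IsMulRightInvariant]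
    (ν : Measure Q) [ν.IsHaarMeasure] [ν.IsMulRightInvariant]
    {X Y W : Set G} (hX : IsCompact X) (hY : IsCompact Y) (hW : IsCompact W) :
    ν (ψ '' (X * Y)) * μ W ^ 2 ≤ μ (X * W) * μ (W⁻¹ * Y) * ν (ψ '' W) := by
  have hψ := S.isOpenQuotientMap.continuous
  have : LocallyCompactSpace Q := S.isOpenQuotientMap.locallyCompactSpace
  have hXW := (hX.mul hW).measure_ne_top (μ := μ)
  have hWY := (hW.inv.mul hY).measure_ne_top (μ := μ)
  have hνW := (hW.image hψ).measure_ne_top (μ := ν)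
  have hνT := ((hX.mul hY).image hψ).measure_ne_top (μ := ν)
  suffices h : ∀ r₁ > μ (X * W), ∀ r₂ > μ (W⁻¹ * Y), ∀ r₃ > ν (ψ '' W),
      ν (ψ '' (X * Y)) * μ W ^ 2 ≤ r₁ * r₂ * r₃ by
    have t (x : ℝ≥0∞) : Filter.Tendsto (x + ·) (nhdsWithin 0 (Set.Ioi 0)) (nhds x) :=
      ((continuous_const.add continuous_id).tendsto' 0 x (add_zero x)).mono_left
        nhdsWithin_le_nhds
    refine ge_of_tendsto (ENNReal.Tendsto.mul (ENNReal.Tendsto.mul (t (μ (X * W)))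
      (.inr hWY) (t (μ (W⁻¹ * Y))) (.inr hXW)) (.inr hνW) (t (ν (ψ '' W)))
      (.inr (ENNReal.mul_ne_top hXW hWY))) ?_
    filter_upwards [self_mem_nhdsWithin] with ε (hε : 0 < ε)
    exact h _ (ENNReal.lt_add_right hXW hε.ne') _ (ENNReal.lt_add_right hWY hε.ne') _
      (ENNReal.lt_add_right hνW hε.ne')
  intro r₁ hr₁ r₂ hr₂ r₃ hr₃
  obtain ⟨O₁, hO₁, hXO, hμ₁⟩ := (hX.mul hW).exists_isOpen_measure_lt_of_isHaarMeasure μ hr₁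
  obtain ⟨O₂, hO₂, hYO, hμ₂⟩ := (hW.inv.mul hY).exists_isOpen_measure_lt_of_isHaarMeasure μ hr₂
  obtain ⟨O₃, hO₃, hWO, hμ₃⟩ := (hW.image hψ).exists_isOpen_measure_lt_of_isHaarMeasure ν hr₃
  -- The tube lemma leaves room around `W`: the support of `f` may exceed `W` while its products
  -- with `X` and `Y` stay in `O₁` and `O₂`.
  obtain ⟨_, U₁, -, hU₁, hXU, hWU₁, hU₁'⟩ := generalized_tube_lemma hX hW
    (n := (fun p : G × G ↦ p.1 * p.2) ⁻¹' O₁) (hO₁.preimage (by fun_prop))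
    fun p hp ↦ hXO (Set.mul_mem_mul hp.1 hp.2)
  obtain ⟨U₂, _, hU₂, -, hWU₂, hYU, hU₂'⟩ := generalized_tube_lemma hW hY
    (n := (fun p : G × G ↦ p.1⁻¹ * p.2) ⁻¹' O₂) (hO₂.preimage (by fun_prop))
    fun p hp ↦ hYO (Set.mul_mem_mul (Set.inv_mem_inv.2 hp.1) hp.2)
  obtain ⟨f, hfW, hf0, hf1, hfU⟩ := hW.exists_compactlySupported_between
    ((hU₁.inter hU₂).inter (hO₃.preimage hψ))
    (Set.subset_inter (Set.subset_inter hWU₁ hWU₂) (Set.image_subset_iff.1 hWO))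
  have hK : IsCompact (tsupport f) := f.hasCompactSupport
  obtain ⟨u, huK, hu0, hu1, huO⟩ := (hX.mul hK).exists_compactlySupported_between hO₁
    (Set.mul_subset_iff.2 fun x hx s hs ↦ hU₁' (a := (x, s)) ⟨hXU hx, (hfU hs).1.1⟩)
  obtain ⟨v, hvK, hv0, hv1, hvO⟩ := (hK.inv.mul hY).exists_compactlySupported_between hO₂
    (Set.mul_subset_iff.2 fun s hs y hy ↦ by
      simpa using hU₂' (a := (s⁻¹, y)) ⟨(hfU hs).1.2, hYU hy⟩)
  have key := measureReal_mul_sq_integral_le S μ ν hf0 hu0 hv0 hX hY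
    (fun x hx s ↦ by
      by_cases hs : s ∈ tsupport f
      · rw [huK _ (Set.mul_mem_mul hx hs)]; exact hf1 s
      · rw [image_eq_zero_of_notMem_tsupport hs]; exact hu0 _)
    (fun y hy s ↦ by
      by_cases hs : s ∈ tsupport f
      · rw [hvK _ (Set.mul_mem_mul (Set.inv_mem_inv.2 hs) hy)]; exact hf1 s
      · rw [image_eq_zero_of_notMem_tsupport hs]; exact hv0 _)
  have hu : 0 ≤ ∫ x, u x ∂μ := integral_nonneg hu0
  have hv : 0 ≤ ∫ x, v x ∂μ := integral_nonneg hv0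
  have hf : 0 ≤ ∫ x, f x ∂μ := integral_nonneg hf0
  have hνK := (hK.image hψ).measure_ne_top (μ := ν)
  have key' := ENNReal.ofReal_le_ofReal key
  rw [ENNReal.ofReal_mul measureReal_nonneg, ENNReal.ofReal_mul (mul_nonneg hu hv),
    ENNReal.ofReal_mul hu, ENNReal.ofReal_pow hf, ofReal_measureReal hνT,
    ofReal_measureReal hνK] at key'
  calc _ ≤ _ := by gcongr; exact measure_le_ofReal_integral μ hW.measurableSet hf0 hfW
    _ ≤ _ := key'
    _ ≤ r₁ * r₂ * r₃ := by
      gcongr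
      · exact (ofReal_integral_le_measure μ hu0 hu1 huO).trans hμ₁.le
      · exact (ofReal_integral_le_measure μ hv0 hv1 hvO).trans hμ₂.le
      · exact (measure_mono (Set.image_subset_iff.2 fun s hs ↦ (hfU hs).2)).trans hμ₃.le

theorem IsSigmaCompact.exists_monotone_isCompact {X : Type*} [TopologicalSpace X] {s : Set X}
    (hs : IsSigmaCompact s) :
    ∃ K : ℕ → Set X, Monotone K ∧ (∀ n, IsCompact (K n)) ∧ ⋃ n, K n = s := by
  obtain ⟨K, hK, rfl⟩ := hs
  refine ⟨Set.accumulate K, Set.monotone_accumulate, fun n ↦ ?_, Set.iUnion_accumulate⟩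
  exact (Set.finite_Iic n).isCompact_biUnion fun i _ ↦ hK i

theorem iUnion_mul_iUnion_of_monotone {G : Type*} [Mul G] {X Y : ℕ → Set G} (hX : Monotone X)
    (hY : Monotone Y) : (⋃ n, X n) * (⋃ n, Y n) = ⋃ n, X n * Y n := by
  refine subset_antisymm ?_ (Set.iUnion_subset fun n ↦ Set.mul_subset_mul
    (Set.subset_iUnion _ n) (Set.subset_iUnion _ n))
  rintro _ ⟨x, hx, y, hy, rfl⟩
  obtain ⟨m, hm⟩ := Set.mem_iUnion.1 hx
  obtain ⟨n, hn⟩ := Set.mem_iUnion.1 hy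
  exact Set.mem_iUnion.2 ⟨max m n, Set.mul_mem_mul (hX (le_max_left m n) hm)
    (hY (le_max_right m n) hn)⟩

theorem IsSigmaCompact.mul {G : Type*} [TopologicalSpace G] [Mul G] [ContinuousMul G]
    {X Y : Set G} (hX : IsSigmaCompact X) (hY : IsSigmaCompact Y) : IsSigmaCompact (X * Y) := by
  obtain ⟨X', mX, cX, rfl⟩ := hX.exists_monotone_isCompact
  obtain ⟨Y', mY, cY, rfl⟩ := hY.exists_monotone_isCompact
  exact ⟨_, fun n ↦ (cX n).mul (cY n), (iUnion_mul_iUnion_of_monotone mX mY).symm⟩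

theorem IsSigmaCompact.inv {G : Type*} [TopologicalSpace G] [InvolutiveInv G] [ContinuousInv G]
    {X : Set G} (hX : IsSigmaCompact X) : IsSigmaCompact X⁻¹ := by
  rw [← Set.image_inv_eq_inv]
  exact hX.image continuous_inv

/-- The left side is a supremum over compact exhaustions, and the right side is monotone in the
three sets. -/
theorem IsSigmaCompact.measure_image_mul_mul_sq_le [H.Normal]
    (S : TopologicalGroup.IsSES H.subtype ψ)
    (μ : Measure G) [μ.IsHaarMeasure] [μ.IsMulRightInvariant]
    (ν : Measure Q) [ν.IsHaarMeasure] [ν.IsMulRightInvariant]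
    {X Y W : Set G} (hX : IsSigmaCompact X) (hY : IsSigmaCompact Y) (hW : IsSigmaCompact W) :
    ν (ψ '' (X * Y)) * μ W ^ 2 ≤ μ (X * W) * μ (W⁻¹ * Y) * ν (ψ '' W) := by
  obtain ⟨X', mX, cX, eX⟩ := hX.exists_monotone_isCompact
  obtain ⟨Y', mY, cY, eY⟩ := hY.exists_monotone_isCompact
  obtain ⟨W', mW, cW, eW⟩ := hW.exists_monotone_isCompact
  have mXY : Monotone fun n ↦ ψ '' (X' n * Y' n) := fun m n h ↦
    Set.image_mono (Set.mul_subset_mul (mX h) (mY h))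
  have eXY : ⋃ n, ψ '' (X' n * Y' n) = ψ '' (X * Y) := by
    rw [← Set.image_iUnion, ← iUnion_mul_iUnion_of_monotone mX mY, eX, eY]
  rw [← eXY, mXY.measure_iUnion, ENNReal.iSup_mul]
  refine iSup_le fun m ↦ ?_
  conv_lhs => rw [← eW]
  rw [mW.measure_iUnion, ENNReal.iSup_pow, ENNReal.mul_iSup]
  refine iSup_le fun n ↦ ((cX m).measure_image_mul_mul_sq_le S μ ν (cY m) (cW n)).trans ?_
  have hXm : X' m ⊆ X := eX ▸ Set.subset_iUnion _ m
  have hYm : Y' m ⊆ Y := eY ▸ Set.subset_iUnion _ m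
  have hWn : W' n ⊆ W := eW ▸ Set.subset_iUnion _ n
  have hWn' : (W' n)⁻¹ ⊆ W⁻¹ := Set.inv_subset_inv.2 hWn
  gcongr

theorem IsSigmaCompact.measure_inv {μ : Measure G} [μ.IsHaarMeasure] [μ.IsMulRightInvariant]
    {X : Set G} (hX : IsSigmaCompact X) : μ X⁻¹ = haarScalarFactor μ.inv μ * μ X := by
  obtain ⟨K, mK, cK, rfl⟩ := hX.exists_monotone_isCompact
  rw [← inv_apply, mK.measure_iUnion, mK.measure_iUnion, ENNReal.mul_iSup]
  congr with n
  exact measure_isMulInvariant_eq_smul_of_isCompact_closure μ.inv μ (cK n).closure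

theorem IsSigmaCompact.measure_inv_mul_mul_le (μ : Measure G) [μ.IsHaarMeasure]
    [μ.IsMulRightInvariant] {A : Set G} (hA : IsSigmaCompact A) (hpos : μ A ≠ 0)
    (hfin : μ A ≠ ∞) : μ (A⁻¹ * A) * μ A ≤ μ (A * A) ^ 2 := by
  have S : TopologicalGroup.IsSES (⊥ : Subgroup G).subtype (MonoidHom.id G) :=
    ⟨⟨Topology.IsEmbedding.subtypeVal, by simp⟩, .id, fun x ↦ by simp⟩
  have key := IsSigmaCompact.measure_image_mul_mul_sq_le S μ μ hA.inv hA hA.inv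
  have hinv := hA.measure_inv (μ := μ)
  have hinv' := hA.inv.measure_inv (μ := μ)
  rw [MonoidHom.coe_id, Set.image_id, Set.image_id, ← mul_inv_rev, (hA.mul hA).measure_inv,
    inv_inv, hinv] at key
  rw [inv_inv] at hinv'
  -- The value of `c` is irrelevant: `c²` appears on both sides and cancels once `c ≠ 0`.
  generalize haarScalarFactor μ.inv μ = c at *
  have hc : (c : ℝ≥0∞) ≠ 0 := fun h ↦ hpos (by rw [hinv', h, zero_mul])
  have hcm : (c : ℝ≥0∞) ^ 2 * μ A ≠ 0 := mul_ne_zero (pow_ne_zero 2 hc) hpos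
  have hcm' : (c : ℝ≥0∞) ^ 2 * μ A ≠ ∞ := ENNReal.mul_ne_top (by simp) hfin
  rw [← ENNReal.mul_le_mul_iff_right hcm hcm']
  calc _ = μ (A⁻¹ * A) * (c * μ A) ^ 2 := by ring
    _ ≤ _ := key
    _ = _ := by ring

end Covering

/-! ### The three bounds -/

theorem theorem4p2
    {G : Type*} [Group G] [TopologicalSpace G] [IsTopologicalGroup G]
    [LocallyCompactSpace G] [T2Space G] [MeasurableSpace G] [BorelSpace G]
    -- a Haar measure on `G`; `G` is unimodular
    (μ : Measure G) [μ.IsHaarMeasure] [μ.IsMulRightInvariant]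
    -- a closed normal subgroup
    (H : Subgroup G) [H.Normal] (hH : IsClosed (H : Set G))
    -- a Haar measure on `G ⧸ H` (with its Borel sets); `G ⧸ H` is unimodular
    [MeasurableSpace (G ⧸ H)] [BorelSpace (G ⧸ H)]
    (ν : Measure (G ⧸ H)) [ν.IsHaarMeasure] [ν.IsMulRightInvariant]
    -- a σ-compact set of positive, finite measure
    (A : Set G) (hA : IsSigmaCompact A) (hpos : 0 < μ A) (hfin : μ A < ∞) :
    (∀ K : ℝ≥0, μ (A * A) ≤ K * μ A → A = A⁻¹ →
      ν ((QuotientGroup.mk' H '' A) * (QuotientGroup.mk' H '' A)) ≤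
        (K : ℝ≥0∞) ^ 2 * ν (QuotientGroup.mk' H '' A)) ∧
    (∀ K : ℝ≥0, μ (A * A) ≤ K * μ A →
      ν ((QuotientGroup.mk' H '' A) * (QuotientGroup.mk' H '' A)) ≤
        (K : ℝ≥0∞) ^ 3 * ν (QuotientGroup.mk' H '' A)) ∧
    (∀ K₁ K₂ : ℝ≥0, μ (A * A) ≤ K₁ * μ A → μ (A⁻¹ * A) ≤ K₂ * μ A →
      ν ((QuotientGroup.mk' H '' A) * (QuotientGroup.mk' H '' A)) ≤
        (K₁ : ℝ≥0∞) * K₂ * ν (QuotientGroup.mk' H '' A)) := by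
  have hpos := hpos.ne'
  have hfin := hfin.ne
  have key := hA.measure_image_mul_mul_sq_le
    (TopologicalGroup.IsSES.ofClosedSubgroup H hH) μ ν hA hA
  rw [Set.image_mul] at key
  have main (K₁ K₂ : ℝ≥0) (h₁ : μ (A * A) ≤ K₁ * μ A) (h₂ : μ (A⁻¹ * A) ≤ K₂ * μ A) :
      ν ((QuotientGroup.mk' H '' A) * (QuotientGroup.mk' H '' A)) ≤
        (K₁ : ℝ≥0∞) * K₂ * ν (QuotientGroup.mk' H '' A) := by
    rw [← ENNReal.mul_le_mul_iff_left (pow_ne_zero 2 hpos) (ENNReal.pow_ne_top hfin)]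
    calc _ ≤ _ := key
      _ ≤ (K₁ * μ A) * (K₂ * μ A) * ν (QuotientGroup.mk' H '' A) := by gcongr
      _ = _ := by ring
  refine ⟨fun K hK hsymm ↦ ?_, fun K hK ↦ ?_, main⟩
  · rw [sq]
    exact main K K hK (by rwa [← hsymm])
  · have hK' : μ (A⁻¹ * A) ≤ (K ^ 2 : ℝ≥0) * μ A := by
      rw [← ENNReal.mul_le_mul_iff_left hpos hfin]
      calc _ ≤ _ := hA.measure_inv_mul_mul_le μ hpos hfin
        _ ≤ (K * μ A) ^ 2 := by gcongr
        _ = _ := by push_cast; ring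
    refine (main K (K ^ 2) hK hK').trans_eq ?_
    push_cast
    ring
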